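/- Let $L=\{<,\ldots\}$ be a countable first-order language with a distinguished binary relation symbol $<$. Let $T$ be a complete $L$-theory in which $<$ is a linear order and which has Skolem functions, i.e. for every $L$-formula $\varphi(\bar y,x)$ there is an $L$-term $\tau(\bar y)$ with $T\vdash\forall\bar y\,(\exists x\,\varphi(\bar y,x)\to\varphi(\bar y,\tau(\bar y)))$. Suppose $T$ satisfies the inaccessibility scheme: for every $L$-formula $\varphi(\bar x,\bar t)$ with finite tuples of variables $\bar x,\bar t$, $$T\vdash(\forall z_0)(\exists z_1>z_0)(\forall\bar y_0)(\exists\bar y_1<z_1)(\forall\bar t<z_0)\bigl(\varphi(\bar y_0,\bar t)\leftrightarrow\varphi(\bar y_1,\bar t)\bigr),$$ where $\bar y_0,\bar y_1$ have the length of $\bar x$, and $\bar t<z$ means that every entry of $\bar t$ is less than $z$. For a model $M$ of $T$ and a regular cardinal $\kappa$, write $\mathrm{cof}(M)=\kappa$ if $\kappa$ is the least cardinal such that $M$ has a strictly increasing cofinal sequence of length $\kappa$. Let $M$ be a model of $T$ with $\mathrm{cof}(M)=\omega$. Then $M$ has an elementary end extension $N$ (an elementary extension in which every element of $N$ lying below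 some element of $M$ belongs to $M$) such that $\mathrm{cof}(N)=\omega_1$ and, if $|M|$ is uncountable, $|N|=|M|$. -/

import Mathlib

open FirstOrder Cardinal

universe u v w w'

namespace InaccScheme

open FirstOrder.Language

section Syntactic

variable {L : FirstOrder.Language.{u, v}} (lt : L.Relations 2)

/-- The formula `x < y`, where `<` is the distinguished relation symbol `lt`. -/
def ltF {α : Type*} (x y : α) : L.Formula α :=
  lt.formula₂ (Term.var x) (Term.var y)

/-- The formula `t̄ < z`, i.e. every entry of the tuple of variables `t̄` is below `z`. -/
noncomputable def tupleLtF {α : Type*} {m : ℕ} (t : Fin m → α) (z : α) : L.Formula α :=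
  Formula.iInf fun i => ltF lt (t i) z

/-- The formula `E_φ(ȳ₀, ȳ₁; z₀) = (∀ t̄ < z₀) (φ(ȳ₀, t̄) ≡ φ(ȳ₁, t̄))`. The variables of
`φ(x̄, t̄)` are indexed by `Fin n ⊕ Fin m`, the left summand being `x̄`, the right one `t̄`. -/
noncomputable def EF {α : Type*} {n m : ℕ} (φ : L.Formula (Fin n ⊕ Fin m))
    (y₀ y₁ : Fin n → α) (z₀ : α) : L.Formula α :=
  Formula.iAlls (Fin m)
    ((tupleLtF lt Sum.inr (Sum.inl z₀)).imp
      ((φ.relabel (Sum.map y₀ id)).iff (φ.relabel (Sum.map y₁ id))))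

/-- The instance of the inaccessibility scheme for `φ(x̄, t̄)`: the sentence
`(∀ z₀) (∃ z₁ > z₀) (∀ ȳ₀) (∃ ȳ₁ < z₁) E_φ(ȳ₀, ȳ₁; z₀)`. -/
noncomputable def inaccessibilitySentence {n m : ℕ} (φ : L.Formula (Fin n ⊕ Fin m)) :
    L.Sentence :=
  Formula.iAlls (α := Empty) (Fin 1) <| Formula.iExs (Fin 1) <|
    ltF lt (Sum.inl (Sum.inr 0)) (Sum.inr 0) ⊓
      (Formula.iAlls (Fin n) <| Formula.iExs (Fin n) <|
        tupleLtF lt Sum.inr (Sum.inl (Sum.inl (Sum.inr 0))) ⊓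
          EF lt φ (fun i => Sum.inl (Sum.inr i)) Sum.inr
            (Sum.inl (Sum.inl (Sum.inl (Sum.inr 0)))))

/-- The theory `T` satisfies the inaccessibility scheme: all its instances are consequences
of `T`. -/
def SatisfiesInaccessibilityScheme (T : L.Theory) : Prop :=
  ∀ (n m : ℕ) (φ : L.Formula (Fin n ⊕ Fin m)), T ⊨ᵇ inaccessibilitySentence lt φ

/-- The sentence `(∀ x) (∀ y) (x < y ∨ x = y ∨ y < x)`. -/
noncomputable def trichotomySentence : L.Sentence :=
  Formula.iAlls (α := Empty) (Fin 2)
    (ltF lt (Sum.inr 0) (Sum.inr 1) ⊔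
      (Term.equal (Term.var (Sum.inr 0)) (Term.var (Sum.inr 1)) ⊔
        ltF lt (Sum.inr 1) (Sum.inr 0)))

/-- In `T` the symbol `lt` is interpreted as a (strict) linear order. -/
def IsLinearlyOrderedBy (T : L.Theory) : Prop :=
  T ⊨ᵇ lt.irreflexive ∧ T ⊨ᵇ lt.transitive ∧ T ⊨ᵇ trichotomySentence lt

/-- `T` has Skolem functions: for every formula `φ(ȳ, x)` there is a term `τ(ȳ)` of the language
with `T ⊢ (∀ ȳ) ((∃ x) φ(ȳ, x) → φ(ȳ, τ(ȳ)))`. -/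
def HasSkolemFunctions (T : L.Theory) : Prop :=
  ∀ (n : ℕ) (φ : L.Formula (Fin n ⊕ Fin 1)), ∃ τ : L.Term (Fin n),
    T ⊨ᵇ (Formula.iExs (Fin 1) φ).imp (φ.subst (Sum.elim Term.var fun _ => τ))

end Syntactic

section Semantic

variable {L : FirstOrder.Language.{u, v}} (lt : L.Relations 2)

/-- The interpretation of the symbol `lt` in the structure `M`. -/
def ltOn (M : Type w) [L.Structure M] (a b : M) : Prop :=
  Structure.RelMap lt ![a, b]

/-- There is a strictly increasing cofinal sequence of elements of `M` of length `κ`. -/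
def HasCofinalSequence (M : Type w) [L.Structure M] (κ : Cardinal.{w}) : Prop :=
  ∃ f : κ.ord.ToType → M,
    (∀ i j, i < j → ltOn lt M (f i) (f j)) ∧ ∀ a : M, ∃ i, a = f i ∨ ltOn lt M a (f i)

/-- `cof(M) = κ`, for a regular cardinal `κ`: it is the least cardinal that is the length of a
strictly increasing cofinal sequence of elements of `M`. -/
def HasCofinality (M : Type w) [L.Structure M] (κ : Cardinal.{w}) : Prop :=
  IsLeast {μ : Cardinal.{w} | HasCofinalSequence lt M μ} κ

/-- The elementary embedding `j` makes `N` an end extension of (the image of) `M`: every element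
of `N` below an element of `M` lies in `M`. -/
def IsEndEmbedding {M : Type w} {N : Type w'} [L.Structure M] [L.Structure N]
    (j : M ↪ₑ[L] N) : Prop :=
  ∀ (a : M) (b : N), ltOn lt N b (j a) → b ∈ Set.range j

end Semantic

section Facts

variable {L : FirstOrder.Language.{u, v}} (lt : L.Relations 2) {M : Type w} [L.Structure M]

theorem realize_ltF {α : Type*} {x y : α} {s : α → M} :
    (ltF lt x y).Realize s ↔ ltOn lt M (s x) (s y) := by
  simp [ltF, ltOn, Formula.realize_rel₂]

theorem realize_tupleLtF {α : Type*} {m : ℕ} {t : Fin m → α} {z : α} {s : α → M} :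
    (tupleLtF lt t z).Realize s ↔ ∀ i, ltOn lt M (s (t i)) (s z) := by
  simp [tupleLtF, realize_ltF]

theorem realize_EF {α : Type*} {n m : ℕ} (φ : L.Formula (Fin n ⊕ Fin m))
    {y₀ y₁ : Fin n → α} {z₀ : α} {s : α → M} :
    (EF lt φ y₀ y₁ z₀).Realize s ↔ ∀ t : Fin m → M, (∀ i, ltOn lt M (t i) (s z₀)) →
      (φ.Realize (Sum.elim (s ∘ y₀) t) ↔ φ.Realize (Sum.elim (s ∘ y₁) t)) := by
  simp only [EF, Formula.realize_iAlls, Formula.realize_imp, realize_tupleLtF,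
    Formula.realize_iff, Formula.realize_relabel, Sum.elim_inl, Sum.elim_inr]
  refine forall_congr' fun t => imp_congr_right fun _ => ?_
  have h : ∀ y : Fin n → α,
      ((fun a => Sum.elim s t a) ∘ Sum.map y id) = Sum.elim (s ∘ y) t := by
    intro y; funext i; rcases i with i | i <;> rfl
  rw [h, h]

theorem realize_inaccessibilitySentence {n m : ℕ} (φ : L.Formula (Fin n ⊕ Fin m)) :
    M ⊨ inaccessibilitySentence lt φ ↔
      ∀ z₀ : M, ∃ z₁ : M, ltOn lt M z₀ z₁ ∧ ∀ y₀ : Fin n → M, ∃ y₁ : Fin n → M,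
        (∀ i, ltOn lt M (y₁ i) z₁) ∧ ∀ t : Fin m → M, (∀ i, ltOn lt M (t i) z₀) →
          (φ.Realize (Sum.elim y₀ t) ↔ φ.Realize (Sum.elim y₁ t)) := by
  simp only [inaccessibilitySentence, Sentence.Realize, Formula.realize_iAlls,
    Formula.realize_iExs, Formula.realize_inf, realize_ltF, realize_tupleLtF, realize_EF,
    Sum.elim_inl, Sum.elim_inr, Function.comp_def]
  constructor
  · intro h z₀
    obtain ⟨z₁, h₁, h₂⟩ := h fun _ => z₀
    exact ⟨z₁ 0, h₁, h₂⟩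
  · intro h z₀
    obtain ⟨z₁, h₁, h₂⟩ := h (z₀ 0)
    exact ⟨fun _ => z₁, h₁, h₂⟩

theorem realize_trichotomySentence :
    M ⊨ trichotomySentence lt ↔ ∀ a b : M, ltOn lt M a b ∨ a = b ∨ ltOn lt M b a := by
  simp only [trichotomySentence, Sentence.Realize, Formula.realize_iAlls, Formula.realize_sup,
    Formula.realize_equal, realize_ltF, Term.realize_var, Sum.elim_inr]
  exact ⟨fun h a b => h ![a, b], fun h i => h (i 0) (i 1)⟩

end Facts

end InaccScheme

/-! Two consequences of the scheme carry the proof. First, regularity (`bounded_union`): a definable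
family of bounded sets, indexed by tuples below some `z`, has bounded union. Secondly, a pigeonhole
principle (`exists_decides`): the `φ`-types over the elements below `a` all have representatives
below one `z`, so every unbounded definable set contains an unbounded definable subset on which the
`φ`-type below `a` is constant.

Let `C` be countable and cofinal in `M`. There are only countably many pairs of a formula and a
point of `C`, so a decreasing sequence of unbounded definable sets handles them all; let `u` be an
ultrafilter containing these sets. In the ultrapower, take the Skolem hull of the constants and the
class `c` of the identity. It is elementary, `c` lies above `M`, and a term value below an element
of `M` is constant on a set in `u`, hence belongs to `M`. By regularity the hull again has countable
cofinality, so the step can be repeated (`exists_endExtension`).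

Countable unions of end extensions preserve countable cofinality, so the step can be iterated `ω₁`
times, with a new element above everything at each stage. These elements are cofinal in the union,
and a countable subset of the union already lies inside one stage, so the cofinality is `ω₁`. The
size is at most `ℵ₁ * #M`. -/

namespace InaccScheme

open FirstOrder.Language

/-! ### Reduction to finitely many parameters -/

section Parameters

variable {L : FirstOrder.Language.{u, v}} {M : Type w} {β : Type*}

/-- A formula with parameters only uses finitely many of them. -/
theorem exists_formula_finite_params [L.Structure M] (φ : L.Formula (β ⊕ M)) :
    ∃ (k : ℕ) (ψ : L.Formula (β ⊕ Fin k)) (p : Fin k → M), ∀ y : β → M,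
      φ.Realize (Sum.elim y id) ↔ ψ.Realize (Sum.elim y p) := by
  classical
  let A := φ.freeVarFinset.toRight
  let f : φ.freeVarFinset → β ⊕ Fin A.card := fun x =>
    match x with
    | ⟨Sum.inl b, _⟩ => Sum.inl b
    | ⟨Sum.inr m, h⟩ => Sum.inr (A.equivFin ⟨m, by simpa [A] using h⟩)
  refine ⟨A.card, BoundedFormula.restrictFreeVar φ f, fun i => (A.equivFin.symm i : M), fun y => ?_⟩
  refine (BoundedFormula.realize_restrictFreeVar _ ?_).symm
  rintro ⟨b | m, h⟩ <;> simp [f]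

/-- A term with parameters only uses finitely many of them. -/
theorem exists_term_finite_params (τ : L.Term (β ⊕ M)) :
    ∃ (k : ℕ) (σ : L.Term (β ⊕ Fin k)) (p : Fin k → M),
      ∀ {N : Type w'} [L.Structure N] (y : β → N) (g : M → N),
        τ.realize (Sum.elim y g) = σ.realize (Sum.elim y (g ∘ p)) := by
  classical
  let A := τ.varFinset.toRight
  let f : τ.varFinset → β ⊕ Fin A.card := fun x =>
    match x with
    | ⟨Sum.inl b, _⟩ => Sum.inl b
    | ⟨Sum.inr m, h⟩ => Sum.inr (A.equivFin ⟨m, by simpa [A] using h⟩)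
  refine ⟨A.card, τ.restrictVar f, fun i => (A.equivFin.symm i : M), fun y g => ?_⟩
  refine (Term.realize_restrictVar _ ?_).symm
  rintro ⟨b | m, h⟩ <;> simp [f]

end Parameters

/-! ### Inaccessible structures: scheme with parameters and regularity -/

section Models

variable {L : FirstOrder.Language.{u, v}} (lt : L.Relations 2)

/-- The semantic content of the hypotheses on the theory, for a single structure: a linear order
with Skolem terms satisfying the inaccessibility scheme. -/
structure IsInaccessible (M : Type w) [L.Structure M] : Prop where
  irrefl : ∀ a : M, ¬ ltOn lt M a a
  trans : ∀ {a b c : M}, ltOn lt M a b → ltOn lt M b c → ltOn lt M a c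
  tri : ∀ a b : M, ltOn lt M a b ∨ a = b ∨ ltOn lt M b a
  scheme : ∀ {n m : ℕ} (φ : L.Formula (Fin n ⊕ Fin m)) (z₀ : M), ∃ z₁ : M, ltOn lt M z₀ z₁ ∧
    ∀ y₀ : Fin n → M, ∃ y₁ : Fin n → M, (∀ i, ltOn lt M (y₁ i) z₁) ∧
      ∀ t : Fin m → M, (∀ i, ltOn lt M (t i) z₀) →
        (φ.Realize (Sum.elim y₀ t) ↔ φ.Realize (Sum.elim y₁ t))
  skolem : ∀ {n : ℕ} (φ : L.Formula (Fin n ⊕ Fin 1)), ∃ τ : L.Term (Fin n), ∀ (v : Fin n → M)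
    (a : M), φ.Realize (Sum.elim v fun _ => a) → φ.Realize (Sum.elim v fun _ => τ.realize v)

theorem isInaccessible_of_model {T : L.Theory} (horder : IsLinearlyOrderedBy lt T)
    (hskolem : HasSkolemFunctions T) (hscheme : SatisfiesInaccessibilityScheme lt T)
    (M : Type w) [L.Structure M] [Nonempty M] (hM : M ⊨ T) : IsInaccessible lt M := by
  have := hM
  refine ⟨?_, ?_, ?_, ?_, ?_⟩
  · have h := Relations.realize_irreflexive.1 (horder.1.realize_sentence M)
    exact fun a => h.irrefl a
  · have h := Relations.realize_transitive.1 (horder.2.1.realize_sentence M)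
    exact fun {a b c} => h.trans a b c
  · exact (realize_trichotomySentence lt).1 (horder.2.2.realize_sentence M)
  · intro n m φ
    exact (realize_inaccessibilitySentence lt φ).1 ((hscheme n m φ).realize_sentence M)
  · intro n φ
    obtain ⟨τ, hτ⟩ := hskolem n φ
    refine ⟨τ, fun v a ha => ?_⟩
    have h := hτ.realize_formula M (v := v)
    simp only [Formula.realize_imp, Formula.realize_iExs] at h
    have h' := h ⟨_, ha⟩
    unfold Formula.Realize at h'
    rw [BoundedFormula.realize_subst] at h'
    unfold Formula.Realize
    convert h' using 1
    funext i
    rcases i with i | i <;> rfl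

namespace IsInaccessible

variable {lt} {M : Type w} [L.Structure M] (h : IsInaccessible lt M)
include h

theorem exists_gt (a : M) : ∃ b, ltOn lt M a b := by
  obtain ⟨b, hb, -⟩ := h.scheme (n := 0) (m := 0) ⊤ a
  exact ⟨b, hb⟩

theorem not_lt_of_lt {a b : M} (hab : ltOn lt M a b) : ¬ ltOn lt M b a :=
  fun hba => h.irrefl a (h.trans hab hba)

theorem lt_of_not_lt_of_lt {a b c : M} (hba : ¬ ltOn lt M b a) (hbc : ltOn lt M b c) :
    ltOn lt M a c := by
  rcases h.tri a b with h1 | rfl | h1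
  · exact h.trans h1 hbc
  · exact hbc
  · exact absurd h1 hba

theorem exists_gt_pair (a b : M) : ∃ c, ltOn lt M a c ∧ ltOn lt M b c := by
  rcases h.tri a b with h1 | rfl | h1
  · obtain ⟨c, hc⟩ := h.exists_gt b
    exact ⟨c, h.trans h1 hc, hc⟩
  · obtain ⟨c, hc⟩ := h.exists_gt a
    exact ⟨c, hc, hc⟩
  · obtain ⟨c, hc⟩ := h.exists_gt a
    exact ⟨c, hc, h.trans h1 hc⟩

theorem exists_gt_tuple {k : ℕ} (a : M) (p : Fin k → M) :
    ∃ c, ltOn lt M a c ∧ ∀ i, ltOn lt M (p i) c := by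
  induction k with
  | zero =>
    obtain ⟨c, hc⟩ := h.exists_gt a
    exact ⟨c, hc, fun i => i.elim0⟩
  | succ k ih =>
    obtain ⟨c, hc, hp⟩ := ih (fun i => p i.castSucc)
    obtain ⟨d, hcd, hd⟩ := h.exists_gt_pair c (p (Fin.last k))
    refine ⟨d, h.trans hc hcd, fun i => ?_⟩
    induction i using Fin.lastCases with
    | last => exact hd
    | cast i => exact h.trans (hp i) hcd

/-- The inaccessibility scheme for formulas with parameters. -/
theorem scheme_params {n k : ℕ} (φ : L.Formula ((Fin n ⊕ Fin k) ⊕ M)) (z₀ : M) :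
    ∃ z₁ : M, ltOn lt M z₀ z₁ ∧ ∀ y₀ : Fin n → M, ∃ y₁ : Fin n → M, (∀ i, ltOn lt M (y₁ i) z₁) ∧
      ∀ t : Fin k → M, (∀ i, ltOn lt M (t i) z₀) →
        (φ.Realize (Sum.elim (Sum.elim y₀ t) id) ↔ φ.Realize (Sum.elim (Sum.elim y₁ t) id)) := by
  obtain ⟨q, ψ, p, hψ⟩ := exists_formula_finite_params φ
  let e : (Fin n ⊕ Fin k) ⊕ Fin q → Fin n ⊕ Fin (k + q) :=
    Sum.map id finSumFinEquiv ∘ Equiv.sumAssoc _ _ _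
  -- Once `z₀` is raised above the parameters, they can be passed as further entries of `t̄`.
  obtain ⟨z, hz, hpz⟩ := h.exists_gt_tuple z₀ p
  obtain ⟨z₁, hz₁, H⟩ := h.scheme (ψ.relabel e) z
  refine ⟨z₁, h.trans hz hz₁, fun y₀ => ?_⟩
  obtain ⟨y₁, hy₁, H⟩ := H y₀
  refine ⟨y₁, hy₁, fun t ht => ?_⟩
  have key : ∀ y : Fin n → M, (Sum.elim y (Fin.append t p)) ∘ e = Sum.elim (Sum.elim y t) p := by
    intro y
    funext i
    rcases i with (i | i) | i <;> simp [e]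
  have := H (Fin.append t p) fun i => by
    induction i using Fin.addCases with
    | left i => simpa using h.trans (ht i) hz
    | right i => simpa using hpz i
  simpa only [Formula.realize_relabel, key, ← hψ] using this

/-- The regularity scheme: a definable family, indexed by tuples below `z`, of bounded sets has
a bounded union. -/
theorem bounded_union {k : ℕ} (θ : L.Formula ((Fin 1 ⊕ Fin k) ⊕ M)) (z : M)
    (hθ : ∀ t : Fin k → M, (∀ i, ltOn lt M (t i) z) →
      ∃ b, ∀ y, θ.Realize (Sum.elim (Sum.elim (fun _ => y) t) id) → ltOn lt M y b) :
    ∃ b, ∀ t : Fin k → M, (∀ i, ltOn lt M (t i) z) →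
      ∀ y, θ.Realize (Sum.elim (Sum.elim (fun _ => y) t) id) → ltOn lt M y b := by
  let r : (Fin 1 ⊕ Fin k) ⊕ M → ((Fin 1 ⊕ Fin k) ⊕ M) ⊕ Fin 1 :=
    Sum.elim (Sum.elim Sum.inr fun j => Sum.inl (Sum.inl (Sum.inr j))) fun a => Sum.inl (Sum.inr a)
  -- `φ(y, t)` says that `y` is not a strict upper bound of the set `θ(·, t)`.
  let φ : L.Formula ((Fin 1 ⊕ Fin k) ⊕ M) := Formula.iExs (Fin 1)
    ((ltF lt (Sum.inr 0) (Sum.inl (Sum.inl (Sum.inl 0)))).not ⊓ θ.relabel r)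
  have hφ : ∀ (y : M) (t : Fin k → M),
      φ.Realize (Sum.elim (Sum.elim (fun _ => y) t) id) ↔
        ∃ x, ¬ ltOn lt M x y ∧ θ.Realize (Sum.elim (Sum.elim (fun _ => x) t) id) := by
    intro y t
    have key : ∀ i : Fin 1 → M, Sum.elim (Sum.elim (Sum.elim (fun _ => y) t) id) i ∘ r =
        Sum.elim (Sum.elim (fun _ => i 0) t) id := by
      intro i
      funext j
      rcases j with (j | j) | j
      · simp [r, Subsingleton.elim j 0]
      · rfl
      · rfl
    simp only [φ, Formula.realize_iExs, Formula.realize_inf, Formula.realize_not, realize_ltF,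
      Formula.realize_relabel, key, Sum.elim_inl, Sum.elim_inr]
    exact ⟨fun ⟨i, hi⟩ => ⟨i 0, hi⟩, fun ⟨x, hx⟩ => ⟨fun _ => x, hx⟩⟩
  obtain ⟨z₁, -, H⟩ := h.scheme_params φ z
  refine ⟨z₁, fun t ht y hy => ?_⟩
  by_contra hyz
  obtain ⟨b, hb⟩ := hθ t ht
  -- The true bound `b` of the set at `t` has a representative `y₁ < z₁`. An element of the set not
  -- below `z₁` would refute `y₁` as a bound, and hence `b` as well.
  obtain ⟨y₁, hy₁, H⟩ := H fun _ => b
  have e : y₁ = fun _ => y₁ 0 := funext fun i => by rw [Subsingleton.elim i 0]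
  have H := H t ht
  rw [e, hφ, hφ] at H
  obtain ⟨x, hx, hx'⟩ := H.2 ⟨y, fun hlt => hyz (h.trans hlt (hy₁ 0)), hy⟩
  exact hx (hb x hx')

end IsInaccessible

end Models

/-! ### Refining unbounded definable sets; the ultrafilter -/

section Refinement

variable {L : FirstOrder.Language.{u, v}} (lt : L.Relations 2) {M : Type w} [L.Structure M]

variable (L) in
/-- A set definable by a formula with parameters. -/
def ParamDefinable (X : Set M) : Prop :=
  ∃ ψ : L.Formula (Fin 1 ⊕ M), ∀ x, x ∈ X ↔ ψ.Realize (Sum.elim (fun _ => x) id)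

/-- A set without strict upper bound. -/
def IsUnbounded (X : Set M) : Prop :=
  ∀ a, ∃ x ∈ X, ltOn lt M a x

/-- The elements of `X` lie above `a` and satisfy the same instances `φ(x, t̄)` with `t̄ < a`. -/
def Decides {m : ℕ} (φ : L.Formula (Fin 1 ⊕ Fin m)) (a : M) (X : Set M) : Prop :=
  (∀ x ∈ X, ltOn lt M a x) ∧ ∀ x ∈ X, ∀ x' ∈ X, ∀ t : Fin m → M, (∀ i, ltOn lt M (t i) a) →
    (φ.Realize (Sum.elim (fun _ => x) t) ↔ φ.Realize (Sum.elim (fun _ => x') t))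

variable {lt}

/-- A pigeonhole argument. The equivalence "same instances of `φ` below `a`" has representatives of
all its classes below one `z`. If every class met `X` in a bounded set, regularity would bound the
union over these representatives, which is `X` itself. -/
theorem IsInaccessible.exists_decides (h : IsInaccessible lt M) {X : Set M}
    (hX : ParamDefinable L X) (hX' : IsUnbounded lt X) {m : ℕ} (φ : L.Formula (Fin 1 ⊕ Fin m))
    (a : M) : ∃ Y ⊆ X, ParamDefinable L Y ∧ IsUnbounded lt Y ∧ Decides lt φ a Y := by
  obtain ⟨ψ, hψ⟩ := hX
  obtain ⟨z, -, hz⟩ := h.scheme φ a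
  let E : M → M → Prop := fun x y => ∀ t : Fin m → M, (∀ i, ltOn lt M (t i) a) →
    (φ.Realize (Sum.elim (fun _ => x) t) ↔ φ.Realize (Sum.elim (fun _ => y) t))
  have main : ∃ y, IsUnbounded lt {x | x ∈ X ∧ E x y} := by
    by_contra hcon
    have hbd : ∀ y, ∃ b, ∀ x, x ∈ X → E x y → ltOn lt M x b := by
      intro y
      by_contra hy
      refine hcon ⟨y, fun b => ?_⟩
      by_contra hb
      obtain ⟨b', hb'⟩ := h.exists_gt b
      refine hy ⟨b', fun x hx hE => ?_⟩
      exact h.lt_of_not_lt_of_lt (fun hlt => hb ⟨x, ⟨hx, hE⟩, hlt⟩) hb'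
    let r : Fin 1 ⊕ M → (Fin 1 ⊕ Fin 1) ⊕ M := Sum.map Sum.inl id
    let θ : L.Formula ((Fin 1 ⊕ Fin 1) ⊕ M) :=
      ψ.relabel r ⊓ EF lt φ (fun _ => Sum.inl (Sum.inl 0)) (fun _ => Sum.inl (Sum.inr 0))
        (Sum.inr a)
    have hθ : ∀ (x : M) (t : Fin 1 → M),
        θ.Realize (Sum.elim (Sum.elim (fun _ => x) t) id) ↔ x ∈ X ∧ E x (t 0) := by
      intro x t
      have key : Sum.elim (Sum.elim (fun _ => x) t) id ∘ r = Sum.elim (fun _ => x) id := by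
        funext i
        rcases i with i | i <;> rfl
      simp only [θ, Formula.realize_inf, Formula.realize_relabel, key, ← hψ, realize_EF, E]
      rfl
    obtain ⟨b, hb⟩ := h.bounded_union θ z fun t _ => by
      obtain ⟨b, hb⟩ := hbd (t 0)
      exact ⟨b, fun x hx => hb x ((hθ x t).1 hx).1 ((hθ x t).1 hx).2⟩
    obtain ⟨x, hx, hbx⟩ := hX' b
    obtain ⟨y, hyz, hy⟩ := hz fun _ => x
    have e : y = fun _ => y 0 := funext fun i => by rw [Subsingleton.elim i 0]
    refine h.not_lt_of_lt hbx (hb y hyz x ((hθ x y).2 ⟨hx, fun t ht => ?_⟩))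
    rw [hy t ht, ← e]
  obtain ⟨y, hy⟩ := main
  refine ⟨{x | (x ∈ X ∧ E x y) ∧ ltOn lt M a x}, fun x hx => hx.1.1, ?_, ?_, fun x hx => hx.2, ?_⟩
  · refine ⟨(ψ ⊓ EF lt φ (fun _ => Sum.inl 0) (fun _ => Sum.inr y) (Sum.inr a)) ⊓
      ltF lt (Sum.inr a) (Sum.inl 0), fun x => ?_⟩
    simp only [Formula.realize_inf, ← hψ, realize_EF, realize_ltF]
    rfl
  · intro b
    obtain ⟨c, hac, hbc⟩ := h.exists_gt_pair a b
    obtain ⟨x, hx, hcx⟩ := hy c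
    exact ⟨x, ⟨hx, h.trans hac hcx⟩, h.trans hbc hcx⟩
  · intro x hx x' hx' t ht
    exact (hx.1.2 t ht).trans (hx'.1.2 t ht).symm

/-- Countability of the language and of `C` leaves countably many requests, met one after another
along a decreasing sequence; thus no limit step, where unboundedness could be lost, is needed. -/
theorem IsInaccessible.exists_ultrafilter [Countable L.Symbols] (h : IsInaccessible lt M)
    {C : Set M} (hC : C.Countable) (hne : C.Nonempty) :
    ∃ u : Ultrafilter M, ∀ (m : ℕ) (φ : L.Formula (Fin 1 ⊕ Fin m)), ∀ a ∈ C,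
      ∃ X ∈ u, Decides lt φ a X := by
  have := hC.to_subtype
  have := hne.to_subtype
  have : Nonempty ((Σ m, L.Formula (Fin 1 ⊕ Fin m)) × C) := ⟨⟨0, ⊤⟩, Classical.arbitrary _⟩
  obtain ⟨e, he⟩ := exists_surjective_nat ((Σ m, L.Formula (Fin 1 ⊕ Fin m)) × C)
  let P := {X : Set M // ParamDefinable L X ∧ IsUnbounded lt X}
  have step : ∀ (n : ℕ) (X : P), ∃ Y : P, Y.1 ⊆ X.1 ∧ Decides lt (e n).1.2 ((e n).2 : M) Y.1 := by
    intro n X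
    obtain ⟨Y, hYX, hY, hY', hd⟩ := h.exists_decides X.2.1 X.2.2 (e n).1.2 ((e n).2 : M)
    exact ⟨⟨Y, hY, hY'⟩, hYX, hd⟩
  choose F hF hF' using step
  let X₀ : P := ⟨Set.univ, ⟨⊤, fun x => by simp⟩, fun a => by
    obtain ⟨b, hb⟩ := h.exists_gt a
    exact ⟨b, trivial, hb⟩⟩
  let X : ℕ → P := fun n => Nat.rec X₀ F n
  have hanti : Antitone fun n => (X n).1 := antitone_nat_of_succ_le fun n => hF n (X n)
  have : Nonempty M := hne.to_type
  have hnb : (⨅ n, Filter.principal (X n).1).NeBot := by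
    refine Filter.iInf_neBot_of_directed ?_ fun n => ?_
    · exact (Filter.monotone_principal.comp_antitone hanti).directed_ge
    · obtain ⟨x, hx, -⟩ := (X n).2.2 (Classical.arbitrary M)
      exact Filter.principal_neBot_iff.2 ⟨x, hx⟩
  refine ⟨Ultrafilter.of (⨅ n, Filter.principal (X n).1), fun m φ a ha => ?_⟩
  obtain ⟨n, hn⟩ := he ⟨⟨m, φ⟩, ⟨a, ha⟩⟩
  refine ⟨(X (n + 1)).1, ?_, ?_⟩
  · exact Ultrafilter.of_le _ (Filter.mem_iInf_of_mem (n + 1) (Filter.mem_principal_self _))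
  · have := hF' n (X n)
    rw [hn] at this
    exact this

/-- In the presence of Skolem terms every substructure is elementary. -/
theorem IsInaccessible.isElementary (h : IsInaccessible lt M) (S : L.Substructure M) :
    S.IsElementary := by
  refine S.isElementary_of_exists fun n φ x a ha => ?_
  let r : Empty ⊕ Fin (n + 1) → Fin n ⊕ Fin 1 :=
    Sum.elim Empty.elim (Fin.lastCases (Sum.inr 0) Sum.inl)
  obtain ⟨τ, hτ⟩ := h.skolem (φ.toFormula.relabel r)
  have key : ∀ (v : Fin n → M) (b : M),
      (φ.toFormula.relabel r).Realize (Sum.elim v fun _ => b) ↔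
        φ.Realize default (Fin.snoc v b : Fin (n + 1) → M) := by
    intro v b
    rw [Formula.realize_relabel, BoundedFormula.realize_toFormula]
    have : ((Sum.elim v fun _ => b) ∘ r) ∘ Sum.inr = (Fin.snoc v b : Fin (n + 1) → M) := by
      funext i
      induction i using Fin.lastCases <;> simp [r]
    rw [this, Subsingleton.elim ((((Sum.elim v fun _ => b) ∘ r) ∘ Sum.inl)) default]
  refine ⟨τ.realize x, ?_⟩
  rw [← realize_term_substructure]
  exact (key _ _).1 (hτ _ a ((key _ _).2 ha))

theorem ltOn_map {N : Type w'} [L.Structure N] (j : M ↪ₑ[L] N) (a b : M) :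
    ltOn lt N (j a) (j b) ↔ ltOn lt M a b := by
  have e : j ∘ ![a, b] = ![j a, j b] := by
    funext i
    fin_cases i <;> rfl
  rw [ltOn, ← e, j.map_rel, ltOn]

end Refinement

/-! ### The one-step end extension as a Skolem ultrapower -/

section EndExtension

variable {L : FirstOrder.Language.{u, v}} {lt : L.Relations 2} {M : Type w} [L.Structure M]

variable (lt M) in
/-- There is a countable set that is cofinal in the strict sense. -/
def IsCountablyCofinal : Prop :=
  ∃ C : Set M, C.Countable ∧ ∀ a, ∃ c ∈ C, ltOn lt M a c

/-- An elementary extension generated by a single element over a structure of countable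
cofinality has countable cofinality. -/
theorem IsInaccessible.isCountablyCofinal_of_terms [Countable L.Symbols] [Nonempty M]
    {N : Type w'} [L.Structure N] (h : IsInaccessible lt M) (hN : IsInaccessible lt N)
    (j : M ↪ₑ[L] N)
    (hC : IsCountablyCofinal lt M) (c : N)
    (hc : ∀ x : N, ∃ (k : ℕ) (σ : L.Term (Fin 1 ⊕ Fin k)) (p : Fin k → M),
      x = σ.realize (Sum.elim (fun _ => c) (j ∘ p))) : IsCountablyCofinal lt N := by
  obtain ⟨C, hC, hcof⟩ := hC
  have := hC.to_subtype
  -- Regularity inside `N`: for fixed `σ` and `a`, the values `σ(c, t)` with `t < j a` are bounded.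
  -- There are countably many pairs `(σ, a)`, and their bounds are cofinal.
  have bound : ∀ r : (Σ k, L.Term (Fin 1 ⊕ Fin k)) × C, ∃ b : N, ∀ t : Fin r.1.1 → N,
      (∀ i, ltOn lt N (t i) (j r.2)) → ltOn lt N (r.1.2.realize (Sum.elim (fun _ => c) t)) b := by
    rintro ⟨⟨k, σ⟩, a⟩
    let r : Fin 1 ⊕ Fin k → (Fin 1 ⊕ Fin k) ⊕ N :=
      Sum.elim (fun _ => Sum.inr c) fun i => Sum.inl (Sum.inr i)
    let θ : L.Formula ((Fin 1 ⊕ Fin k) ⊕ N) :=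
      Term.equal (Term.var (Sum.inl (Sum.inl 0))) (σ.relabel r)
    have hθ : ∀ (y : N) (t : Fin k → N), θ.Realize (Sum.elim (Sum.elim (fun _ => y) t) id) ↔
        y = σ.realize (Sum.elim (fun _ => c) t) := by
      intro y t
      have key : Sum.elim (Sum.elim (fun _ => y) t) id ∘ r = Sum.elim (fun _ => c) t := by
        funext i
        rcases i with i | i <;> rfl
      simp only [θ, Formula.realize_equal, Term.realize_relabel, key, Term.realize_var]
      rfl
    obtain ⟨b, hb⟩ := hN.bounded_union θ (j a) fun t _ => by
      obtain ⟨b, hb⟩ := hN.exists_gt (σ.realize (Sum.elim (fun _ => c) t))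
      exact ⟨b, fun y hy => (hθ y t).1 hy ▸ hb⟩
    exact ⟨b, fun t ht => hb t ht _ ((hθ _ t).2 rfl)⟩
  choose b hb using bound
  refine ⟨Set.range b, Set.countable_range b, fun x => ?_⟩
  obtain ⟨k, σ, p, rfl⟩ := hc x
  obtain ⟨z, -, hz⟩ := h.exists_gt_tuple (Classical.arbitrary M) p
  obtain ⟨a, ha, hza⟩ := hcof z
  exact ⟨_, ⟨⟨⟨k, σ⟩, ⟨a, ha⟩⟩, rfl⟩, hb ⟨⟨k, σ⟩, ⟨a, ha⟩⟩ _ fun i =>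
    (ltOn_map j _ _).2 (h.trans (hz i) hza)⟩

/-- A model of countable cofinality has an elementary end extension of countable cofinality with
an element above all elements of the model. -/
theorem exists_endExtension [Countable L.Symbols] {T : L.Theory}
    (hT : ∀ (N : Type w) [L.Structure N] [Nonempty N], N ⊨ T → IsInaccessible lt N)
    [Nonempty M] (hM : M ⊨ T) (hcof : IsCountablyCofinal lt M) :
    ∃ (N : Type w) (_ : L.Structure N) (j : M ↪ₑ[L] N), IsEndEmbedding lt j ∧
      (∃ b, ∀ a, ltOn lt N (j a) b) ∧ IsCountablyCofinal lt N ∧ #N ≤ max #M ℵ₀ := by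
  have h := hT M hM
  obtain ⟨C, hC, hCcof⟩ := id hcof
  have hne : C.Nonempty := (hCcof (Classical.arbitrary M)).imp fun _ hc => hc.1
  obtain ⟨u, hu⟩ := h.exists_ultrafilter hC hne
  let U := (u : Filter M).Product fun _ : M => M
  have hU : U ⊨ T := by
    refine ⟨fun φ hφ => ?_⟩
    rw [Ultraproduct.sentence_realize]
    exact Filter.Eventually.of_forall fun _ => hM.realize_of_mem φ hφ
  have hUi : IsInaccessible lt U := hT U hU
  let mk : (M → M) → U := fun f => (f : (u : Filter M).Product fun _ : M => M)
  have hmk : ∀ f g : M → M, mk f = mk g ↔ ∀ᶠ x in (u : Filter M), f x = g x :=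
    fun f g => Quotient.eq''
  have hlt : ∀ f g : M → M, ltOn lt U (mk f) (mk g) ↔
      ∀ᶠ x in (u : Filter M), ltOn lt M (f x) (g x) := by
    intro f g
    have := Ultraproduct.realize_formula_cast (u := u) (M := fun _ : M => M)
      (ltF lt (0 : Fin 2) 1) ![f, g]
    simp only [realize_ltF] at this
    exact this
  let d : M → U := fun a => mk fun _ => a
  let c : U := mk id
  -- The full ultrapower may be too large and need not be an end extension; the hull of `M` and `c`
  -- keeps every element of the form `σ(c, p)`.
  let S : L.Substructure U := Substructure.closure L (insert c (Set.range d))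
  have hS : S.IsElementary := hUi.isElementary S
  have hdS : ∀ a, d a ∈ S := fun a => Substructure.subset_closure (Or.inr ⟨a, rfl⟩)
  have hcS : c ∈ S := Substructure.subset_closure (Or.inl rfl)
  have hd : ∀ {n : ℕ} (φ : L.Formula (Fin n)) (x : Fin n → M), φ.Realize (d ∘ x) ↔ φ.Realize x := by
    intro n φ x
    have := Ultraproduct.realize_formula_cast (u := u) (M := fun _ : M => M) φ fun i _ => x i
    refine this.trans ?_
    simp
  let S' : L.ElementarySubstructure U := ⟨S, hS⟩
  let j : M ↪ₑ[L] S' :=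
    { toFun := fun a => ⟨d a, hdS a⟩
      map_formula' := fun n φ x => by
        rw [← hd φ x, ← S'.subtype.map_formula]
        rfl }
  have hreal : ∀ {k : ℕ} (σ : L.Term (Fin 1 ⊕ Fin k)) (p : Fin k → M),
      σ.realize (Sum.elim (fun _ => c) (d ∘ p)) =
        mk fun y => σ.realize (Sum.elim (fun _ => y) p) := by
    intro k σ p
    have := Ultraproduct.term_realize_cast (u := u) (M := fun _ : M => M)
      (Sum.elim (fun _ => id) fun i _ => p i) σ
    have e₁ : Sum.elim (fun _ => c) (d ∘ p) =
        fun i => mk ((Sum.elim (fun _ => id) fun i _ => p i : Fin 1 ⊕ Fin k → M → M) i) := by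
      funext i
      rcases i with i | i <;> rfl
    have e₂ : ∀ y, (fun i => (Sum.elim (fun _ => id) fun i _ => p i : Fin 1 ⊕ Fin k → M → M) i y) =
        Sum.elim (fun _ => y) p := by
      intro y
      funext i
      rcases i with i | i <;> rfl
    simp only [e₂] at this
    rw [e₁]
    exact this
  have hterm : ∀ x : S', ∃ (k : ℕ) (σ : L.Term (Fin 1 ⊕ Fin k)) (p : Fin k → M),
      (x : U) = σ.realize (Sum.elim (fun _ => c) (d ∘ p)) := by
    rintro ⟨x, hx⟩
    obtain ⟨t, rfl⟩ := Substructure.mem_closure_iff_exists_term.1 hx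
    have : ∀ y : (insert c (Set.range d) : Set U), ∃ r : Fin 1 ⊕ M,
        (y : U) = Sum.elim (fun _ => c) d r := by
      rintro ⟨y, rfl | ⟨a, rfl⟩⟩
      · exact ⟨Sum.inl 0, rfl⟩
      · exact ⟨Sum.inr a, rfl⟩
    choose r hr using this
    obtain ⟨k, σ, p, hσ⟩ := exists_term_finite_params.{u, v, w, w} (t.relabel r)
    refine ⟨k, σ, p, ?_⟩
    rw [← hσ, Term.realize_relabel]
    exact congrArg (fun v => Term.realize v t) (funext hr)
  have hNT : S' ⊨ T := (S'.theory_model_iff T).2 hU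
  have : Nonempty S' := ⟨⟨c, hcS⟩⟩
  refine ⟨S', inferInstance, j, ?_, ⟨⟨c, hcS⟩, fun a => ?_⟩, ?_, ?_⟩
  · intro a x hxa
    obtain ⟨k, σ, p, hx⟩ := hterm x
    rw [hreal] at hx
    rw [← ltOn_map S'.subtype] at hxa
    change ltOn lt U x (d a) at hxa
    rw [hx, hlt] at hxa
    obtain ⟨z, haz, hz⟩ := h.exists_gt_tuple a p
    -- The ultrafilter decides formulas only below points of `C`, so `e` is taken above `a` and all
    -- of `p`.
    obtain ⟨e, he, hze⟩ := hCcof z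
    let φ : L.Formula (Fin 1 ⊕ Fin (k + 1)) := Term.equal (σ.relabel (Sum.map id Fin.castSucc))
      (Term.var (Sum.inr (Fin.last k)))
    have hφ : ∀ y s : M, φ.Realize (Sum.elim (fun _ => y) (Fin.snoc p s : Fin (k + 1) → M)) ↔
        σ.realize (Sum.elim (fun _ => y) p) = s := by
      intro y s
      have key : Sum.elim (fun _ => y) (Fin.snoc p s : Fin (k + 1) → M) ∘
          Sum.map id Fin.castSucc = Sum.elim (fun _ : Fin 1 => y) p := by
        funext i
        rcases i with i | i <;> simp
      simp [φ, Formula.realize_equal, Term.realize_relabel, key]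
    -- On `X` the truth of `σ(y, p) = s` is independent of `y` for each `s < e`. Since some `y₀ ∈ X`
    -- gives a value below `a < e`, the term is constant on `X`.
    obtain ⟨X, hXu, -, hX⟩ := hu _ φ e he
    obtain ⟨y₀, hy₀X, hy₀⟩ := u.nonempty_of_mem (Filter.inter_mem hXu hxa)
    let s := σ.realize (Sum.elim (fun _ => y₀) p)
    refine ⟨s, Subtype.ext ?_⟩
    rw [hx]
    refine (hmk _ _).2 (Filter.mem_of_superset hXu fun y hy => ?_)
    refine ((hφ y s).1 ((hX y₀ hy₀X y hy _ fun i => ?_).1 ((hφ y₀ s).2 rfl))).symm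
    induction i using Fin.lastCases with
    | last => simpa using h.trans hy₀ (h.trans haz hze)
    | cast i => simpa using h.trans (hz i) hze
  · rw [← ltOn_map S'.subtype]
    change ltOn lt U (d a) c
    rw [hlt]
    obtain ⟨e, he, hae⟩ := hCcof a
    obtain ⟨X, hXu, hX, -⟩ := hu 0 ⊤ e he
    exact Filter.mem_of_superset hXu fun y hy => h.trans hae (hX y hy)
  · refine h.isCountablyCofinal_of_terms (hT S' hNT) j hcof ⟨c, hcS⟩ fun x => ?_
    obtain ⟨k, σ, p, hx⟩ := hterm x
    refine ⟨k, σ, p, Subtype.ext ?_⟩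
    rw [hx]
    change _ = S'.subtype _
    have e : Sum.elim (fun _ => c) (d ∘ p) =
        S'.subtype ∘ Sum.elim (fun _ : Fin 1 => (⟨c, hcS⟩ : S')) (j ∘ p) := by
      funext i
      rcases i with i | i <;> rfl
    rw [e, HomClass.realize_term]
  · have hle := Substructure.lift_card_closure_le (L := L) (s := insert c (Set.range d))
    have h1 : #(insert c (Set.range d) : Set U) ≤ #M + 1 :=
      (mk_insert_le).trans (add_le_add_left mk_range_le _)
    have h2 : lift.{u} #(insert c (Set.range d) : Set U) + lift.{w} #(Σ i, L.Functions i) ≤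
        lift.{u} (max #M ℵ₀) := by
      rw [lift_max, lift_aleph0]
      refine add_le_of_le (le_max_right _ _) ?_ ?_
      · refine (lift_le.2 h1).trans ?_
        rw [lift_add, lift_one]
        exact add_le_of_le (le_max_right _ _) (le_max_left _ _)
          (one_le_aleph0.trans (le_max_right _ _))
      · refine le_trans ?_ (le_max_right _ _)
        rw [lift_le_aleph0, mk_le_aleph0_iff]
        infer_instance
    refine lift_le.{u}.1 (hle.trans (max_le ?_ h2))
    rw [← lift_aleph0.{u, w}, lift_le]
    exact le_max_right _ _

end EndExtension

/-! ### Direct limits of elementary embeddings -/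

section ElementaryLimit

variable {L : FirstOrder.Language.{u, v}} {ι : Type w'} [Preorder ι] [IsDirectedOrder ι]
  [Nonempty ι] (G : ι → Type w) [∀ i, L.Structure (G i)] (f : ∀ i j, i ≤ j → G i ↪ₑ[L] G j)
  [DirectedSystem G fun i j h => (f i j h).toEmbedding]

/-- Tarski's theorem on unions of elementary chains. -/
theorem realize_directLimit_of {β : Type*} {n : ℕ} (φ : L.BoundedFormula β n) (i : ι)
    (x : β → G i) (y : Fin n → G i) :
    φ.Realize (DirectLimit.of L ι G (fun i j h => (f i j h).toEmbedding) i ∘ x)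
      (DirectLimit.of L ι G (fun i j h => (f i j h).toEmbedding) i ∘ y) ↔ φ.Realize x y := by
  induction φ generalizing i with
  | falsum => rfl
  | equal t₁ t₂ =>
    simp only [BoundedFormula.Realize, ← Sum.comp_elim, HomClass.realize_term]
    exact (DirectLimit.of L ι G (fun i j h => (f i j h).toEmbedding) i).injective.eq_iff
  | rel R ts =>
    simp only [BoundedFormula.Realize, ← Sum.comp_elim, HomClass.realize_term]
    exact (DirectLimit.of L ι G (fun i j h => (f i j h).toEmbedding) i).map_rel R _
  | imp φ ψ ih₁ ih₂ => simp only [BoundedFormula.Realize, ih₁, ih₂]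
  | all φ ih =>
    simp only [BoundedFormula.Realize]
    constructor
    · intro H a
      have := H (DirectLimit.of L ι G (fun i j h => (f i j h).toEmbedding) i a)
      rwa [← Fin.comp_snoc, ih] at this
    · intro H a
      obtain ⟨k, b, rfl⟩ := DirectLimit.exists_of a
      -- The test element may first appear at another index; elementarity of `f i l` moves the
      -- universal statement to a common later one.
      obtain ⟨l, hil, hkl⟩ := directed_of (· ≤ ·) i k
      have H' := ((f i l hil).map_boundedFormula (BoundedFormula.all φ) x y).2 H
      have H' := H' (f k l hkl b)
      rw [← ih] at H'
      have e : DirectLimit.of L ι G (fun i j h => (f i j h).toEmbedding) l ∘ f i l hil =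
          DirectLimit.of L ι G (fun i j h => (f i j h).toEmbedding) i :=
        funext fun _ => DirectLimit.of_f (f := fun i j h => (f i j h).toEmbedding) (hij := hil)
      have e' : DirectLimit.of L ι G (fun i j h => (f i j h).toEmbedding) l (f k l hkl b) =
          DirectLimit.of L ι G (fun i j h => (f i j h).toEmbedding) k b :=
        DirectLimit.of_f (f := fun i j h => (f i j h).toEmbedding) (hij := hkl)
      rwa [Fin.comp_snoc, ← Function.comp_assoc, ← Function.comp_assoc, e, e'] at H'

/-- The canonical elementary embedding of a member of a directed system of elementary embeddings
into its direct limit. -/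
noncomputable def elementaryOf (i : ι) :
    G i ↪ₑ[L] Language.DirectLimit G fun i j h => (f i j h).toEmbedding where
  toFun := DirectLimit.of L ι G (fun i j h => (f i j h).toEmbedding) i
  map_formula' n φ x := by
    have := realize_directLimit_of G f φ i x default
    rw [Formula.Realize, Formula.Realize, ← this]
    congr!

theorem elementaryOf_map {i j : ι} (h : i ≤ j) (x : G i) :
    elementaryOf G f j (f i j h x) = elementaryOf G f i x :=
  DirectLimit.of_f (f := fun i j h => (f i j h).toEmbedding) (hij := h)

theorem exists_elementaryOf (z : Language.DirectLimit G fun i j h => (f i j h).toEmbedding) :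
    ∃ i x, elementaryOf G f i x = z :=
  DirectLimit.exists_of z

theorem isEndEmbedding_elementaryOf (lt : L.Relations 2)
    (hf : ∀ i j h, IsEndEmbedding lt (f i j h)) (i : ι) :
    IsEndEmbedding lt (elementaryOf G f i) := by
  intro a b hb
  obtain ⟨k, b, rfl⟩ := exists_elementaryOf G f b
  obtain ⟨l, hil, hkl⟩ := directed_of (· ≤ ·) i k
  rw [← elementaryOf_map G f hil, ← elementaryOf_map G f hkl, ltOn_map] at hb
  obtain ⟨c, hc⟩ := hf i l hil a _ hb
  exact ⟨c, by rw [← elementaryOf_map G f hil, hc, elementaryOf_map]⟩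

theorem isCountablyCofinal_directLimit [Countable ι] (lt : L.Relations 2)
    (hG : ∀ i, IsCountablyCofinal lt (G i)) :
    IsCountablyCofinal lt (Language.DirectLimit G fun i j h => (f i j h).toEmbedding) := by
  choose C hC hcof using hG
  refine ⟨⋃ i, elementaryOf G f i '' C i, Set.countable_iUnion fun i => (hC i).image _, fun z => ?_⟩
  obtain ⟨i, x, rfl⟩ := exists_elementaryOf G f z
  obtain ⟨c, hc, hxc⟩ := hcof i x
  exact ⟨_, Set.mem_iUnion.2 ⟨i, c, hc, rfl⟩, (ltOn_map _ _ _).2 hxc⟩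

end ElementaryLimit

theorem mk_directLimit_le {L : FirstOrder.Language.{u, v}} {ι : Type w} [Preorder ι]
    [IsDirectedOrder ι] [Nonempty ι] (G : ι → Type w) [∀ i, L.Structure (G i)]
    (f : ∀ i j, i ≤ j → G i ↪ₑ[L] G j)
    [DirectedSystem G fun i j h => (f i j h).toEmbedding] {κ : Cardinal.{w}}
    (hG : ∀ i, #(G i) ≤ κ) :
    #(Language.DirectLimit G fun i j h => (f i j h).toEmbedding) ≤ #ι * κ := by
  have : Function.Surjective fun p : Σ i, G i => elementaryOf G f p.1 p.2 := fun z => by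
    obtain ⟨i, x, hx⟩ := exists_elementaryOf G f z
    exact ⟨⟨i, x⟩, hx⟩
  refine (mk_le_of_surjective this).trans ?_
  rw [mk_sigma]
  exact (sum_le_sum _ (fun _ => κ) hG).trans (by simp)

theorem IsEndEmbedding.comp {L : FirstOrder.Language.{u, v}} {lt : L.Relations 2}
    {M N P : Type*} [L.Structure M] [L.Structure N] [L.Structure P] {k : N ↪ₑ[L] P}
    {j : M ↪ₑ[L] N} (hk : IsEndEmbedding lt k) (hj : IsEndEmbedding lt j) :
    IsEndEmbedding lt (k.comp j) := by
  intro a c hc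
  obtain ⟨b, rfl⟩ := hk _ _ hc
  obtain ⟨a', rfl⟩ := hj a b ((ltOn_map k _ _).1 hc)
  exact ⟨a', rfl⟩

/-! ### Labelled stages and upper bounds of countable chains -/

section Stages

variable {L : FirstOrder.Language.{u, v}} (lt : L.Relations 2) (T : L.Theory) (U : Type w)
  (κ : Cardinal.{w})

/-- A model of `T` of countable cofinality and of size at most `κ`, with elements labelled by
elements of `U`. -/
structure Stage where
  carrier : Type w
  str : L.Structure carrier
  nonempty : Nonempty carrier
  label : carrier → U
  label_injective : Function.Injective label
  model : carrier ⊨ T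
  cofinal : IsCountablyCofinal lt carrier
  card_le : #carrier ≤ κ

attribute [instance] Stage.str Stage.nonempty

namespace Stage

variable {lt T U κ}

/-- `p ≤ q` if `q` is an elementary end extension of `p`, where `p` is identified with a subset
of `q` by the labels. -/
instance : Preorder (Stage lt T U κ) where
  le p q := ∃ j : p.carrier ↪ₑ[L] q.carrier,
    (∀ x, q.label (j x) = p.label x) ∧ IsEndEmbedding lt j
  le_refl p := ⟨ElementaryEmbedding.refl L _, fun _ => rfl, fun _ b _ => ⟨b, rfl⟩⟩
  le_trans p q r := by
    rintro ⟨j, hj, hj'⟩ ⟨k, hk, hk'⟩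
    exact ⟨k.comp j, fun x => (hk _).trans (hj x), hk'.comp hj'⟩

/-- The elementary end embedding witnessing `p ≤ q`. -/
noncomputable def map {p q : Stage lt T U κ} (h : p ≤ q) : p.carrier ↪ₑ[L] q.carrier :=
  Classical.choose h

theorem label_map {p q : Stage lt T U κ} (h : p ≤ q) (x : p.carrier) :
    q.label (map h x) = p.label x :=
  (Classical.choose_spec h).1 x

theorem isEndEmbedding_map {p q : Stage lt T U κ} (h : p ≤ q) : IsEndEmbedding lt (map h) :=
  (Classical.choose_spec h).2

/-- This is the purpose of the labels: they determine the embedding uniquely, so embeddings chosen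
independently of one another still form a directed system. -/
theorem map_map {p q r : Stage lt T U κ} (h : p ≤ q) (h' : q ≤ r) (x : p.carrier) :
    map h' (map h x) = map (h.trans h') x :=
  r.label_injective (by simp only [label_map])

section Limit

variable {ι : Type w} [Preorder ι] {G : ι → Stage lt T U κ} (hG : Monotone G)

theorem directedSystem : DirectedSystem (fun i => (G i).carrier)
    fun _ _ h => (map (hG h)).toEmbedding where
  map_self i _ := (G i).label_injective (label_map _ _)
  map_map _ _ _ hij hjk x := map_map (hG hij) (hG hjk) x

/-- The union of a directed system of stages. -/
theorem exists_limit [IsDirectedOrder ι] [Nonempty ι] :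
    ∃ (N : Type w) (_ : L.Structure N) (e : ∀ i, (G i).carrier ↪ₑ[L] N),
      (∀ i j (h : i ≤ j) x, e j (map (hG h) x) = e i x) ∧ (∀ z, ∃ i x, e i x = z) ∧
      (∀ i, IsEndEmbedding lt (e i)) ∧ #N ≤ #ι * κ ∧
      (Countable ι → IsCountablyCofinal lt N) := by
  have := directedSystem hG
  let f : ∀ i j, i ≤ j → (G i).carrier ↪ₑ[L] (G j).carrier := fun i j h => map (hG h)
  refine ⟨Language.DirectLimit (fun i => (G i).carrier) fun i j h => (f i j h).toEmbedding,
    inferInstance, elementaryOf (fun i => (G i).carrier) f, ?_, ?_, ?_, ?_, ?_⟩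
  · exact fun i j h x => elementaryOf_map (fun i => (G i).carrier) f h x
  · exact exists_elementaryOf (fun i => (G i).carrier) f
  · exact isEndEmbedding_elementaryOf (fun i => (G i).carrier) f lt
      fun i j h => isEndEmbedding_map (hG h)
  · exact mk_directLimit_le (fun i => (G i).carrier) f fun i => (G i).card_le
  · exact fun _ => isCountablyCofinal_directLimit (fun i => (G i).carrier) f lt
      fun i => (G i).cofinal

include hG in
/-- Every countable directed system of stages is bounded by a stage with an element above all
members of the system. -/
theorem exists_above_directed [Countable L.Symbols]
    (hT : ∀ (N : Type w) [L.Structure N] [Nonempty N], N ⊨ T → IsInaccessible lt N)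
    (hκ : ℵ₀ ≤ κ) (hU : κ < #U) [IsDirectedOrder ι] [Nonempty ι] [Countable ι] :
    ∃ (q : Stage lt T U κ) (b : q.carrier), ∀ i, ∃ h : G i ≤ q,
      ∀ a, ltOn lt q.carrier (map h a) b := by
  obtain ⟨N, _, e, he, hsurj, hend, hcard, hcof⟩ := exists_limit hG
  have i₀ : ι := Classical.arbitrary ι
  have hNT : N ⊨ T := ((e i₀).theory_model_iff T).1 (G i₀).model
  have : Nonempty N := ⟨e i₀ (Classical.arbitrary _)⟩
  have hN : #N ≤ κ := hcard.trans
    ((mul_le_mul_left (mk_le_aleph0 (α := ι)) κ).trans (aleph0_mul_eq hκ).le)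
  obtain ⟨N', _, j, hj, ⟨b, hb⟩, hcof', hcard'⟩ := exists_endExtension hT hNT (hcof inferInstance)
  have hN' : #N' ≤ κ := hcard'.trans (max_le hN hκ)
  choose r x hx using hsurj
  let lab : N → U := fun z => (G (r z)).label (x z)
  -- Points of the union coincide exactly when their labels do, so the union inherits an injective
  -- labelling.
  have key : ∀ i k (y : (G i).carrier) (z : (G k).carrier),
      e i y = e k z ↔ (G i).label y = (G k).label z := by
    intro i k y z
    obtain ⟨l, hil, hkl⟩ := directed_of (· ≤ ·) i k
    rw [← he i l hil, ← he k l hkl, (e l).injective.eq_iff, ← label_map (hG hil),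
      ← label_map (hG hkl), (G l).label_injective.eq_iff]
  have hlab : ∀ i y, lab (e i y) = (G i).label y := fun i y => (key _ _ _ _).1 (hx _)
  have hlabinj : Function.Injective lab := by
    intro y z hyz
    rw [← hx y, ← hx z]
    exact (key _ _ _ _).2 hyz
  have hUinf : Infinite U := infinite_iff.2 (hκ.trans hU.le)
  -- At most `κ < #U` labels are in use, so enough remain for the new elements of `N'`.
  have hcompl : #N' ≤ #((Set.range lab)ᶜ : Set U) := by
    rw [mk_compl_of_infinite _ ((mk_range_le.trans hN).trans_lt hU)]
    exact hN'.trans hU.le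
  obtain ⟨k⟩ := hcompl
  let lab' : N' → U := Function.extend j lab fun z => k z
  have hlab' : ∀ z, lab' (j z) = lab z := fun z => j.injective.extend_apply _ _ z
  have hlab'' : ∀ z, (¬ ∃ y, j y = z) → lab' z = k z := fun z hz => Function.extend_apply' _ _ _ hz
  have hlabinj' : Function.Injective lab' := by
    intro y z hyz
    by_cases hy : ∃ y', j y' = y <;> by_cases hz : ∃ z', j z' = z
    · obtain ⟨y, rfl⟩ := hy
      obtain ⟨z, rfl⟩ := hz
      rw [hlab', hlab'] at hyz
      rw [hlabinj hyz]
    · obtain ⟨y, rfl⟩ := hy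
      rw [hlab', hlab'' z hz] at hyz
      exact absurd ⟨y, hyz⟩ (k z).2
    · obtain ⟨z, rfl⟩ := hz
      rw [hlab', hlab'' y hy] at hyz
      exact absurd ⟨z, hyz.symm⟩ (k y).2
    · rw [hlab'' y hy, hlab'' z hz] at hyz
      exact k.injective (Subtype.ext hyz)
  let q : Stage lt T U κ := ⟨N', inferInstance, ⟨b⟩, lab', hlabinj',
    (j.theory_model_iff T).1 hNT, hcof', hN'⟩
  have hq : ∀ i y, q.label (j (e i y)) = (G i).label y := fun i y => (hlab' _).trans (hlab i y)
  have hle : ∀ i, G i ≤ q := fun i => ⟨j.comp (e i), hq i, hj.comp (hend i)⟩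
  refine ⟨q, b, fun i => ⟨hle i, fun a => ?_⟩⟩
  have : map (hle i) a = j (e i a) := q.label_injective ((label_map _ _).trans (hq i a).symm)
  rw [this]
  exact hb _

end Limit

/-- `y` is a stage above `x` with a marked element above all elements of `x`. -/
def Above (x y : Σ p : Stage lt T U κ, p.carrier) : Prop :=
  ∃ h : x.1 ≤ y.1, ∀ a, ltOn lt y.1.carrier (map h a) y.2

/-- Pairwise comparability makes the underlying stages directed once the order of stages is pulled
back to the index type. Equality is allowed in `hg` because an enumeration may repeat members. -/
theorem exists_above [Countable L.Symbols]
    (hT : ∀ (N : Type w) [L.Structure N] [Nonempty N], N ⊨ T → IsInaccessible lt N)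
    (hκ : ℵ₀ ≤ κ) (hU : κ < #U) {ι : Type w} [Countable ι] [Nonempty ι]
    (g : ι → Σ p : Stage lt T U κ, p.carrier)
    (hg : ∀ i j, Above (g i) (g j) ∨ g i = g j ∨ Above (g j) (g i)) :
    ∃ x, ∀ i, Above (g i) x := by
  let G : ι → Stage lt T U κ := fun i => (g i).1
  let : Preorder ι := Preorder.lift G
  have : IsDirectedOrder ι := ⟨fun i j => by
    rcases hg i j with h | h | h
    · exact ⟨j, h.1, le_refl (G j)⟩
    · exact ⟨j, show G i ≤ G j from (congrArg Sigma.fst h).le, le_refl (G j)⟩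
    · exact ⟨i, le_refl (G i), h.1⟩⟩
  obtain ⟨q, b, hq⟩ := exists_above_directed (G := G) (fun _ _ h => h) hT hκ hU
  exact ⟨⟨q, b⟩, hq⟩

end Stage

end Stages

/-! ### Transfinite recursion along countable initial segments -/

/-- If every nonempty countable chain of a relation has an upper bound, there are chains of every
well-ordered type with countable initial segments. -/
theorem exists_chain_of_countable_bounds {X : Type*} {R : X → X → Prop} {Ω : Type*}
    [LinearOrder Ω] [WellFoundedLT Ω] (hΩ : ∀ a : Ω, (Set.Iio a).Countable) (x₀ : X)
    (H : ∀ g : ℕ → X, (∀ i j, R (g i) (g j) ∨ g i = g j ∨ R (g j) (g i)) → ∃ x, ∀ n, R (g n) x) :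
    ∃ g : Ω → X, (∀ a, R x₀ (g a)) ∧ ∀ a b, a < b → R (g a) (g b) := by
  classical
  -- Each value is chosen above `x₀` and all earlier values directly, so `R` need not be transitive.
  -- The `else` value is junk; `main` shows that a bound always exists. Including `x₀` also keeps
  -- the set nonempty at the least index, so that it can be enumerated by `ℕ`.
  let F : ∀ a : Ω, (∀ b, b < a → X) → X := fun a prev =>
    if h : ∃ x, ∀ y ∈ insert x₀ (Set.range fun b : Set.Iio a => prev b b.2), R y x then h.choose
    else x₀
  let g : Ω → X := wellFounded_lt.fix F
  have hg : ∀ a, (∃ x, ∀ y ∈ insert x₀ (g '' Set.Iio a), R y x) →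
      ∀ y ∈ insert x₀ (g '' Set.Iio a), R y (g a) := by
    intro a h
    have e : g '' Set.Iio a = Set.range fun b : Set.Iio a => g b := Set.image_eq_range _ _
    rw [e] at h ⊢
    have : g a = h.choose := by
      rw [show g a = F a fun b _ => g b from wellFounded_lt.fix_eq F a]
      exact dif_pos h
    rw [this]
    exact h.choose_spec
  have main : ∀ a, R x₀ (g a) ∧ ∀ b < a, R (g b) (g a) := by
    intro a
    induction a using WellFoundedLT.induction with
    | ind a ih =>
      have hex : ∃ x, ∀ y ∈ insert x₀ (g '' Set.Iio a), R y x := by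
        have hc : (insert x₀ (g '' Set.Iio a)).Countable := ((hΩ a).image g).insert _
        obtain ⟨e, he⟩ := hc.exists_eq_range (Set.insert_nonempty _ _)
        have hchain : ∀ y ∈ insert x₀ (g '' Set.Iio a), ∀ z ∈ insert x₀ (g '' Set.Iio a),
            R y z ∨ y = z ∨ R z y := by
          rintro y (rfl | ⟨b, hb, rfl⟩) z (rfl | ⟨c, hc, rfl⟩)
          · exact Or.inr (Or.inl rfl)
          · exact Or.inl (ih c hc).1
          · exact Or.inr (Or.inr (ih b hb).1)
          · rcases lt_trichotomy b c with h | rfl | h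
            · exact Or.inl ((ih c hc).2 b h)
            · exact Or.inr (Or.inl rfl)
            · exact Or.inr (Or.inr ((ih b hb).2 c h))
        rw [he] at hchain ⊢
        obtain ⟨x, hx⟩ := H e fun i j => hchain _ ⟨i, rfl⟩ _ ⟨j, rfl⟩
        exact ⟨x, by rintro _ ⟨n, rfl⟩; exact hx n⟩
      have := hg a hex
      exact ⟨this _ (Or.inl rfl), fun b hb => this _ (Or.inr ⟨b, hb, rfl⟩)⟩
  exact ⟨g, fun a => (main a).1, fun a b hab => (main b).2 a hab⟩

end InaccScheme

/-! ### The union of the `ω₁`-chain -/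

theorem corollary3p1 {L : FirstOrder.Language.{u, v}} [Countable L.Symbols]
    (lt : L.Relations 2) (T : L.Theory)
    (hcomplete : T.IsComplete)
    (horder : InaccScheme.IsLinearlyOrderedBy lt T)
    (hskolem : InaccScheme.HasSkolemFunctions T)
    (hscheme : InaccScheme.SatisfiesInaccessibilityScheme lt T)
    (M : Type w) [L.Structure M] (hM : M ⊨ T)
    (hcof : InaccScheme.HasCofinality lt M ℵ₀) :
    ∃ (N : Type w) (_ : L.Structure N) (j : M ↪ₑ[L] N),
      InaccScheme.IsEndEmbedding lt j ∧
      InaccScheme.HasCofinality lt N ℵ₁ ∧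
      (ℵ₀ < #M → #N = #M) := by
  obtain ⟨⟨s, hs, hscof⟩, -⟩ := hcof
  have hT : ∀ (N : Type w) [L.Structure N] [Nonempty N], N ⊨ T → InaccScheme.IsInaccessible lt N :=
    fun N _ _ hN => InaccScheme.isInaccessible_of_model lt horder hskolem hscheme N hN
  have hcard : ℵ₀ ≤ #(ℵ₀ : Cardinal.{w}).ord.ToType := (mk_ord_toType _).ge
  have : Infinite (ℵ₀ : Cardinal.{w}).ord.ToType := infinite_iff.2 hcard
  have : Nonempty M := ⟨s (Classical.arbitrary _)⟩
  have hMi := hT M hM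
  have hsinj : Function.Injective s := by
    intro i k hik
    rcases lt_trichotomy i k with h | h | h
    · exact absurd (hik ▸ hs i k h) (hMi.irrefl _)
    · exact h
    · exact absurd (hik ▸ hs k i h) (hMi.irrefl _)
  have hMinf : ℵ₀ ≤ #M := hcard.trans (mk_le_of_injective hsinj)
  have hMcof : InaccScheme.IsCountablyCofinal lt M := by
    have : Countable (ℵ₀ : Cardinal.{w}).ord.ToType := mk_le_aleph0_iff.1 (mk_ord_toType _).le
    refine ⟨Set.range s, Set.countable_range s, fun a => ?_⟩
    obtain ⟨b, hab⟩ := hMi.exists_gt a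
    obtain ⟨i, rfl | hi⟩ := hscof b
    · exact ⟨_, ⟨i, rfl⟩, hab⟩
    · exact ⟨_, ⟨i, rfl⟩, hMi.trans hab hi⟩
  -- By Cantor, the power set of `M` has more labels than any stage of size at most `#M` can use.
  let base : InaccScheme.Stage lt T (Set M) #M :=
    ⟨M, inferInstance, inferInstance, fun a => {a}, Set.singleton_injective, hM, hMcof, le_rfl⟩
  let Ω : Type w := (ℵ₁ : Cardinal.{w}).ord.ToType
  have hΩcard : #Ω = ℵ₁ := mk_ord_toType _
  have hΩ : ∀ a : Ω, (Set.Iio a).Countable := fun a => by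
    rw [← le_aleph0_iff_set_countable, ← Order.lt_succ_iff, succ_aleph0]
    exact (mk_Iio_lt a (by simp [Ω])).trans_eq hΩcard
  have : NoMaxOrder Ω := Cardinal.noMaxOrder (aleph0_le_aleph 1)
  have : Nonempty Ω := mk_ne_zero_iff.1 (by rw [hΩcard]; exact (aleph_pos 1).ne')
  obtain ⟨g, hg₀, hg⟩ := InaccScheme.exists_chain_of_countable_bounds hΩ
    (⟨base, Classical.arbitrary M⟩ : Σ p : InaccScheme.Stage lt T (Set M) #M, p.carrier)
    fun g hg => by
      obtain ⟨x, hx⟩ := InaccScheme.Stage.exists_above hT hMinf (by rw [mk_set]; exact cantor _)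
        (fun n : ULift.{w} ℕ => g n.down) fun i k => hg i.down k.down
      exact ⟨x, fun n => hx ⟨n⟩⟩
  have hmono : Monotone fun a => (g a).1 := fun a b hab => by
    rcases hab.eq_or_lt with rfl | h
    · exact le_rfl
    · exact (hg a b h).1
  obtain ⟨N, _, e, he, hsurj, hend, hNcard, -⟩ := InaccScheme.Stage.exists_limit hmono
  have a₀ : Ω := Classical.arbitrary Ω
  have : Nonempty N := ⟨e a₀ (Classical.arbitrary _)⟩
  have hNi := hT N (((e a₀).theory_model_iff T).1 (g a₀).1.model)
  let j : M ↪ₑ[L] N := (e a₀).comp (InaccScheme.Stage.map (hg₀ a₀).1)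
  -- The marked element of stage `b` lies above every earlier stage, so the marks are increasing and
  -- cofinal in the union.
  let f : Ω → N := fun a => e a (g a).2
  have hf : ∀ a b, a < b → ∀ x, InaccScheme.ltOn lt N (e a x) (f b) := by
    intro a b hab x
    rw [← he a b hab.le]
    exact (InaccScheme.ltOn_map (e b) _ _).2 ((hg a b hab).2 x)
  refine ⟨N, inferInstance, j, (hend a₀).comp (InaccScheme.Stage.isEndEmbedding_map _),
    ⟨⟨f, fun a b hab => hf a b hab _, fun z => ?_⟩, ?_⟩, fun hunc => ?_⟩
  · obtain ⟨a, x, rfl⟩ := hsurj z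
    obtain ⟨b, hab⟩ := exists_gt a
    exact ⟨b, Or.inr (hf a b hab x)⟩
  · rintro μ ⟨t, -, ht⟩
    by_contra hμ
    have hc : Countable μ.ord.ToType := by
      rw [← mk_le_aleph0_iff, mk_ord_toType]
      rw [not_le, ← succ_aleph0] at hμ
      exact Order.lt_succ_iff.1 hμ
    choose a x hx using hsurj
    -- Countably many elements come from countably many stages, and countable subsets of `ω₁` are
    -- bounded. The mark `f b` then exceeds every `t i`.
    have : ∃ b : Ω, ∀ i, a (t i) < b := by
      by_contra! hb
      have hcov : (Set.univ : Set Ω) ⊆ ⋃ i, Set.Iic (a (t i)) := fun b _ =>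
        Set.mem_iUnion.2 (hb b)
      have hcount : (⋃ i, Set.Iic (a (t i))).Countable := Set.countable_iUnion fun i => by
        obtain ⟨c, hc⟩ := exists_gt (a (t i))
        exact (hΩ c).mono fun d hd => lt_of_le_of_lt hd hc
      have := (hcount.mono hcov)
      rw [Set.countable_univ_iff, ← mk_le_aleph0_iff, hΩcard] at this
      exact absurd this aleph0_lt_aleph_one.not_ge
    obtain ⟨b, hb⟩ := this
    obtain ⟨i, hi⟩ := ht (f b)
    have hlt := hf _ _ (hb i) (x (t i))
    rw [hx] at hlt
    rcases hi with hi | hi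
    · exact hNi.irrefl _ (hi ▸ hlt)
    · exact hNi.not_lt_of_lt hlt hi
  · refine le_antisymm (hNcard.trans ?_) (mk_le_of_injective j.injective)
    rw [hΩcard]
    -- Uncountability of `M` enters here: `ℵ₁ ≤ #M` lets `#M` absorb the factor `ℵ₁`.
    refine (mul_le_max_of_aleph0_le_left (aleph0_le_aleph 1)).trans (max_le ?_ le_rfl)
    rw [← succ_aleph0]
    exact Order.succ_le_of_lt hunc
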